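/- Let $k$ be an algebraically closed field of characteristic $0$ and let $(R,\mathfrak m)$ be a Noetherian complete local domain of Krull dimension one that is a $k$-algebra with residue field $k$ (via $k\to R\to R/\mathfrak m$). Let $n=\mu(\mathfrak m)$ be the embedding dimension of $R$, let $\overline R$ be the integral closure of $R$ in its fraction field $Q$, let $\mathfrak C=R:_Q\overline R$ be the conductor, and let $x\in\mathfrak m$ generate a minimal reduction of $\mathfrak m$. Let $s=\dim_k\,(\mathfrak C,x)/(x)$ be the reduced type of $R$. Write $R\cong k[[X_1,\dots,X_n]]/I$, and let $\Omega_R$ be the universally finite module of differentials of $R$ over $k$, i.e. the cokernel of the Jacobian matrix of a generating set of $I$, $\Omega_R=R^n/\langle(\partial f/\partial X_1,\dots,\partial f/\partial X_n) : f\in I\rangle$; let $\tau(\Omega_R)$ be its torsion submodule. If $\mathfrak m^4\subseteq(\mathfrak C,x)$ and $n(n-3)\ge 2s$, then $\tau(\Omega_R)\neq 0$. In particular Berger's conjecture holds for $R$: $R$ is regular if and only if $\tau(\Omega_R)=0$. -/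

import Mathlib

open IsLocalRing

/-- The conductor `R :_Q R̄` of a domain `R` in its integral closure `R̄` inside the fraction
field `Q`. It is contained in `R`, and is regarded as an ideal of `R`. -/
noncomputable def conductorIdeal (R : Type*) [CommRing R] [IsDomain R] : Ideal R :=
  ((1 : Submodule R (FractionRing R)) /
    Subalgebra.toSubmodule (integralClosure R (FractionRing R))).comap
      (Algebra.linearMap R (FractionRing R))

/-- `J` is a reduction of `I`: `J ⊆ I` and `J I ^ r = I ^ (r + 1)` for some `r`. -/
def IsReductionOf {R : Type*} [CommRing R] (J I : Ideal R) : Prop :=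
  J ≤ I ∧ ∃ r : ℕ, J * I ^ r = I ^ (r + 1)

/-- `J` is a minimal reduction of `I`: a reduction of `I` that is minimal under inclusion. -/
def IsMinimalReductionOf {R : Type*} [CommRing R] (J I : Ideal R) : Prop :=
  Minimal (fun J' : Ideal R => IsReductionOf J' I) J

/-- The reduced type `dim_k (𝔠, x) / (x)`, where `𝔠` is the conductor of `R`; the quotient
`(𝔠, x) / (x)` is the image of the ideal `(𝔠, x)` in `R / (x)`. -/
noncomputable def reducedType (k R : Type*) [Field k] [CommRing R] [IsDomain R] [Algebra k R]
    (x : R) : ℕ :=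
  Module.finrank k
    ((conductorIdeal R ⊔ Ideal.span {x}).map (Ideal.Quotient.mk (Ideal.span {x})))

/-- The column `(∂f/∂X₁, …, ∂f/∂Xₙ)` of the Jacobian matrix, with entries mapped to `R` along
`Φ : k⟦X₁, …, Xₙ⟧ → R`. -/
noncomputable def jacobianColumn {k R : Type*} [Field k] [CommRing R] [Algebra k R] {n : ℕ}
    (Φ : MvPowerSeries (Fin n) k →ₐ[k] R) (f : MvPowerSeries (Fin n) k) : Fin n → R :=
  fun i => Φ (MvPowerSeries.pderiv k i f)

/-- The universally finite module of differentials of `R = k⟦X₁, …, Xₙ⟧ / I`, where `I` is the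
kernel of the surjection `Φ`: the cokernel of the Jacobian matrix of `I`, that is, `Rⁿ` modulo
the Jacobian columns of the elements of `I`. (If `f₁, …, fₘ` generate `I`, the columns of
`f₁, …, fₘ` span the same submodule, by the product rule.) -/
abbrev UniversallyFiniteDifferentials {k R : Type*} [Field k] [CommRing R] [Algebra k R] {n : ℕ}
    (Φ : MvPowerSeries (Fin n) k →ₐ[k] R) : Type _ :=
  (Fin n → R) ⧸ Submodule.span R (jacobianColumn Φ '' (RingHom.ker Φ : Set (MvPowerSeries (Fin n) k)))

/-- A complete Noetherian local `k`-algebra with residue field `k` is a quotient of a power series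
ring over `k` in as many variables as its embedding dimension, so the presentations over which
`UniversallyFiniteDifferentials` is defined exist. -/
theorem exists_surjective_mvPowerSeries (k R : Type*) [Field k] [CommRing R] [IsLocalRing R]
    [IsNoetherianRing R] [Algebra k R] [IsAdicComplete (maximalIdeal R) R]
    (hres : Function.Bijective (algebraMap k (ResidueField R))) :
    ∃ Φ : MvPowerSeries (Fin (maximalIdeal R).spanFinrank) k →ₐ[k] R, Function.Surjective Φ := by
  set n := (maximalIdeal R).spanFinrank with hn
  set I := maximalIdeal R with hI
  obtain ⟨x, hx⟩ : ∃ x : Fin n → R, Ideal.span (Set.range x) = I := by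
    have hfg : I.FG := IsNoetherian.noetherian I
    have hg := Submodule.FG.generators_ncard hfg
    have hfin : I.generators.Finite := Submodule.FG.finite_generators hfg
    have : Nat.card I.generators = n := hg
    have := hfin.to_subtype
    let e : I.generators ≃ Fin n := (Finite.equivFin _).trans (finCongr ‹_›)
    refine ⟨fun i => (e.symm i : R), ?_⟩
    have : Set.range (fun i => (e.symm i : R)) = I.generators := by
      rw [show (fun i => (e.symm i : R)) = Subtype.val ∘ e.symm from rfl, e.symm.surjective.range_comp]
      simp
    rw [this]
    exact Submodule.span_generators I
  have hxI : ∀ i, x i ∈ I := fun i => hx ▸ Ideal.subset_span ⟨i, rfl⟩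
  have step : ∀ j : ℕ, ∀ r ∈ I ^ j, ∃ p : MvPolynomial (Fin n) k, p.IsHomogeneous j ∧
      r - MvPolynomial.aeval x p ∈ I ^ (j + 1) := by
    have scal : ∀ r : R, ∃ c : k, r - algebraMap k R c ∈ I := by
      intro r
      obtain ⟨c, hc⟩ := hres.2 (residue R r)
      refine ⟨c, ?_⟩
      rw [hI, ← residue_eq_zero_iff, map_sub, ← hc]
      exact sub_self _
    intro j
    induction j with
    | zero =>
      intro r _
      obtain ⟨c, hc⟩ := scal r
      exact ⟨MvPolynomial.C c, MvPolynomial.isHomogeneous_C _ _, by simpa using hc⟩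
    | succ j ih =>
      intro r hr
      rw [pow_succ] at hr
      refine Submodule.mul_induction_on hr ?_ ?_
      · intro a ha b hb
        obtain ⟨p, hp, hpa⟩ := ih a ha
        rw [← hx] at hb
        obtain ⟨c, rfl⟩ := Ideal.mem_span_range_iff_exists_fun.1 hb
        choose l hl using fun i => scal (c i)
        refine ⟨p * ∑ i, MvPolynomial.C (l i) * MvPolynomial.X i, hp.mul ?_, ?_⟩
        · refine MvPolynomial.IsHomogeneous.sum _ _ _ fun i _ => ?_
          simpa using (MvPolynomial.isHomogeneous_C _ _).mul (MvPolynomial.isHomogeneous_X k i)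
        · have h2 : ∑ i, c i * x i - ∑ i, algebraMap k R (l i) * x i ∈ I ^ 2 := by
            rw [← Finset.sum_sub_distrib]
            refine Ideal.sum_mem _ fun i _ => ?_
            rw [← sub_mul, pow_two]
            exact Ideal.mul_mem_mul (hl i) (hxI i)
          have h1 : ∑ i, c i * x i ∈ I := Ideal.sum_mem _ fun i _ => Ideal.mul_mem_left _ _ (hxI i)
          have hpj : MvPolynomial.aeval x p ∈ I ^ j := by
            have := Ideal.sub_mem _ ha (Ideal.pow_le_pow_right (Nat.le_succ j) hpa)
            simpa using this
          have e1 := Ideal.mul_mem_mul hpa h1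
          have e2 := Ideal.mul_mem_mul hpj h2
          rw [← pow_succ] at e1
          rw [← pow_add] at e2
          have := Ideal.add_mem _ e1 e2
          convert this using 1
          simp only [map_mul, map_sum, MvPolynomial.aeval_C, MvPolynomial.aeval_X]
          ring
      · rintro a b ⟨p, hp, hpa⟩ ⟨q, hq, hqb⟩
        refine ⟨p + q, hp.add hq, ?_⟩
        convert Ideal.add_mem _ hpa hqb using 1
        simp only [map_add]; ring
  let : UniformSpace k := ⊥
  have : DiscreteTopology k := ⟨rfl⟩
  let : TopologicalSpace R := I.adicTopology
  have hadic : IsAdic I := rfl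
  have : IsTopologicalRing R := (I.ringFilterBasis).isTopologicalRing
  let : UniformSpace R := IsTopologicalAddGroup.rightUniformSpace R
  have : IsUniformAddGroup R := isUniformAddGroup_of_addCommGroup
  have : IsLinearTopology R R := I.isLinearTopology
  obtain ⟨h1, h2⟩ := hadic.isAdicComplete_iff.1 ‹_›
  have : ContinuousSMul k R := ⟨by
    rw [continuous_prod_of_discrete_left]
    intro c
    simp_rw [Algebra.smul_def]
    exact continuous_const.mul continuous_id⟩
  have ha : MvPowerSeries.HasEval x := by
    refine ⟨fun i => ?_, by simp [Filter.cofinite_eq_bot]⟩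
    refine hadic.hasBasis_nhds_zero.tendsto_right_iff.2 fun N _ => ?_
    filter_upwards [Filter.eventually_ge_atTop N] with m hm
    exact Ideal.pow_le_pow_right hm (Ideal.pow_mem_pow (hxI i) m)
  refine ⟨MvPowerSeries.aeval ha, fun r => ?_⟩
  choose! p hp hpr using step
  let s : ℕ → R := fun j => Nat.rec r (fun j t => t - MvPolynomial.aeval x (p j t)) j
  have hs : ∀ j, s j ∈ I ^ j := by
    intro j
    induction j with
    | zero => simp
    | succ j ih => exact hpr j _ ih
  let f : MvPowerSeries (Fin n) k := fun d => (p d.degree (s d.degree)).coeff d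
  let F : ℕ → MvPolynomial (Fin n) k := fun N => ∑ j ∈ Finset.range N, p j (s j)
  have hF : ∀ N, MvPolynomial.aeval x (F N) = r - s N := by
    intro N
    induction N with
    | zero => simp [F, s]
    | succ N ih =>
      have : s (N + 1) = s N - MvPolynomial.aeval x (p N (s N)) := rfl
      simp only [F, Finset.sum_range_succ, map_add] at ih ⊢
      rw [ih, this]; ring
  open scoped MvPowerSeries.WithPiTopology in
  have hlim : Filter.Tendsto (fun N => (F N : MvPowerSeries (Fin n) k)) Filter.atTop (nhds f) := by
    rw [MvPowerSeries.WithPiTopology.tendsto_iff_coeff_tendsto]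
    intro d
    refine tendsto_const_nhds.congr' ?_
    filter_upwards [Filter.eventually_gt_atTop d.degree] with N hN
    rw [MvPolynomial.coeff_coe, MvPolynomial.coeff_sum]
    rw [Finset.sum_eq_single d.degree]
    · rfl
    · intro b _ hb
      exact (hp b _ (hs b)).coeff_eq_zero (Ne.symm hb)
    · intro h; simp at h; omega
  have t1 := ((MvPowerSeries.continuous_aeval ha).tendsto f).comp hlim
  have t2 : Filter.Tendsto (fun N => r - s N) Filter.atTop (nhds r) := by
    refine (hadic.hasBasis_nhds r).tendsto_right_iff.2 fun N _ => ?_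
    filter_upwards [Filter.eventually_ge_atTop N] with m hm
    refine ⟨- s m, neg_mem (Ideal.pow_le_pow_right hm (hs m)), ?_⟩
    simp [sub_eq_add_neg]
  refine ⟨f, tendsto_nhds_unique t1 (t2.congr fun N => ?_)⟩
  simp [hF]

/-!
Suppose that `Ω` is torsion-free, let `x ∈ 𝔪 \ 𝔪²`, let `𝔟` be an ideal containing `x` and `𝔪⁴`,
and put `Y = Ω / R dx`. Since `R` is finite over `k⟦x⟧`, a derivation of `R` into a torsion-free
module vanishes as soon as it kills `x`; so `Y` is torsion, hence of finite length, and
`dim Y / xY` is the dimension of the `x`-torsion of `Y`. Now `x m = r dx` identifies this torsion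
with the kernel of `R / x → Ω / xΩ`, `r ↦ r dx`, and `dx ∉ xΩ`, whence `dim Y / xY < dim R / x`.

In the other direction the exterior derivative `r ds ↦ dr ∧ ds` induces a map of `Y / xY` onto
`Λ²(𝔪 / (𝔪² + x))` which kills the exact differentials. These contribute `dim R / 𝔟 - 1` further
dimensions: by Euler's identity in characteristic zero, `dr ∈ xΩ + R dx` forces `r ∈ k + 𝔟`.
Altogether `(n - 1).choose 2 ≤ dim 𝔟 / x`, which contradicts `2 dim 𝔟 / x ≤ n (n - 3)`.
-/

section LinearAlgebra

variable {k V W : Type*} [Field k] [AddCommGroup V] [Module k V] [AddCommGroup W] [Module k W]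

theorem finite_range_of_ker_le {P : Type*} [AddCommGroup P] [Module k P]
    {f : P →ₗ[k] V} {g : P →ₗ[k] W} [Module.Finite k f.range] (h : f.ker ≤ g.ker) :
    Module.Finite k g.range := by
  have : Module.Finite k (P ⧸ f.ker) := .equiv f.quotKerEquivRange.symm
  exact f.ker.range_liftQ g h ▸ inferInstance

theorem finrank_range_le_of_ker_le {P : Type*} [AddCommGroup P] [Module k P]
    {f : P →ₗ[k] V} {g : P →ₗ[k] W} [Module.Finite k f.range] (h : f.ker ≤ g.ker) :
    Module.finrank k g.range ≤ Module.finrank k f.range := by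
  let e := f.quotKerEquivRange
  have : Module.Finite k (P ⧸ f.ker) := .equiv e.symm
  rw [← e.finrank_eq, ← f.ker.range_liftQ g h]
  exact LinearMap.finrank_range_le _

theorem finrank_range_add_finrank_range_le {P X Λ T : Type*}
    [AddCommGroup P] [Module k P] [AddCommGroup X] [Module k X] [AddCommGroup Λ] [Module k Λ]
    [AddCommGroup T] [Module k T] [Module.Finite k W]
    {ρ : X →ₗ[k] W} {ψ : X →ₗ[k] Λ} {d : P →ₗ[k] X} {q : P →ₗ[k] T}
    (hψ : ρ.ker ≤ ψ.ker) (hd : ψ ∘ₗ d = 0) (hq : (ρ ∘ₗ d).ker ≤ q.ker) :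
    Module.finrank k ψ.range + Module.finrank k q.range ≤ Module.finrank k W := by
  have hψ' : ((ρ ∘ₗ d).range.mkQ ∘ₗ ρ).ker ≤ ψ.ker := by
    intro m hm
    obtain ⟨r, hr⟩ : ρ m ∈ (ρ ∘ₗ d).range := by simpa [LinearMap.mem_ker] using hm
    have : ψ (m - d r) = 0 := hψ (by simpa [sub_eq_zero] using hr.symm)
    simpa [LinearMap.congr_fun hd r, sub_eq_zero, show ψ (d r) = 0 from LinearMap.congr_fun hd r]
      using this
  calc _ ≤ Module.finrank k (W ⧸ (ρ ∘ₗ d).range) + Module.finrank k (ρ ∘ₗ d).range :=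
        add_le_add ((finrank_range_le_of_ker_le hψ').trans (Submodule.finrank_le _))
          (finrank_range_le_of_ker_le hq)
    _ = Module.finrank k W := Submodule.finrank_quotient_add_finrank _

theorem finrank_sub_one_le_finrank_quotient_span_singleton [Module.Finite k V] (v : V) :
    Module.finrank k V - 1 ≤ Module.finrank k (V ⧸ k ∙ v) := by
  have h1 := (k ∙ v).finrank_quotient_add_finrank
  have h2 := finrank_span_le_card (R := k) ({v} : Set V)
  simp only [Set.toFinset_singleton, Finset.card_singleton] at h2
  omega

theorem finrank_quotient_range_eq_finrank_ker [Module.Finite k V] (f : V →ₗ[k] V) :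
    Module.finrank k (V ⧸ f.range) = Module.finrank k f.ker := by
  have h1 := f.range.finrank_quotient_add_finrank
  have h2 := f.finrank_range_add_finrank_ker
  omega

end LinearAlgebra

section PowerSeries

open MvPowerSeries (C X constantCoeff coeff pderiv)

variable {k σ : Type*} [Field k]

theorem mem_maximalIdeal_mvPowerSeries {f : MvPowerSeries σ k} :
    f ∈ maximalIdeal (MvPowerSeries σ k) ↔ constantCoeff f = 0 := by
  rw [mem_maximalIdeal, mem_nonunits_iff, MvPowerSeries.isUnit_iff_constantCoeff,
    isUnit_iff_ne_zero, not_not]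

theorem sub_C_constantCoeff_mem_maximalIdeal (f : MvPowerSeries σ k) :
    f - C (constantCoeff f) ∈ maximalIdeal (MvPowerSeries σ k) :=
  mem_maximalIdeal_mvPowerSeries.2 (by simp)

theorem X_mem_maximalIdeal_mvPowerSeries (i : σ) : X i ∈ maximalIdeal (MvPowerSeries σ k) :=
  mem_maximalIdeal_mvPowerSeries.2 (by simp)

theorem span_range_X_eq_maximalIdeal [Finite σ] :
    Ideal.span (Set.range X) = maximalIdeal (MvPowerSeries σ k) := by
  classical
  cases nonempty_fintype σ
  refine le_antisymm (Ideal.span_le.2 ?_) fun f hf => ?_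
  · rintro _ ⟨i, rfl⟩
    exact X_mem_maximalIdeal_mvPowerSeries i
  have hvar (m : σ →₀ ℕ) : m ≠ 0 → ∃ i, m i ≠ 0 := Finsupp.ne_iff.1
  rcases isEmpty_or_nonempty σ with _ | _
  · rw [mem_maximalIdeal_mvPowerSeries] at hf
    have : f = 0 := by
      ext m
      rw [Subsingleton.elim m 0]
      exact hf
    simp [this]
  choose! ι hι using hvar
  -- Each nonconstant monomial is assigned to one of the variables dividing it.
  let part (i : σ) : MvPowerSeries σ k := fun m => if ι m = i then coeff m f else 0
  have coeff_part (i m) : coeff m (part i) = if ι m = i then coeff m f else 0 := rfl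
  have hsum : f = ∑ i, part i := by
    ext m
    simp [coeff_part]
  rw [hsum]
  refine Ideal.sum_mem _ fun i _ => ?_
  have hdvd : X i ∣ part i := MvPowerSeries.X_dvd_iff.2 fun m hm => by
    rw [coeff_part, ite_eq_right_iff]
    rintro rfl
    rw [not_imp_not.1 (hι m) hm]
    exact mem_maximalIdeal_mvPowerSeries.1 hf
  exact Ideal.mem_of_dvd _ hdvd (Ideal.subset_span ⟨i, rfl⟩)

theorem eq_zero_of_leibniz_of_apply_X_eq_zero [Finite σ] {A E : Type*} [CommRing A]
    [AddCommGroup E] [Module k E] [Module A E] {I : Ideal A} [IsHausdorff I E]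
    {φ : MvPowerSeries σ k →+* A} (hφ : ∀ i, φ (X i) ∈ I) {Δ : MvPowerSeries σ k →ₗ[k] E}
    (hmul : ∀ f g, Δ (f * g) = φ f • Δ g + φ g • Δ f) (hX : ∀ i, Δ (X i) = 0) : Δ = 0 := by
  cases nonempty_fintype σ
  have hC (c : k) : Δ (C c) = 0 := by
    have h1 : Δ 1 = 0 := by simpa using hmul 1 1
    rw [MvPowerSeries.c_eq_algebraMap, Algebra.algebraMap_eq_smul_one, map_smul, h1, smul_zero]
  have hpow (N : ℕ) (f) : Δ f ∈ I ^ N • (⊤ : Submodule A E) := by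
    induction N generalizing f with
    | zero => simp
    | succ N ih =>
      have hf := sub_C_constantCoeff_mem_maximalIdeal f
      rw [← span_range_X_eq_maximalIdeal, Ideal.mem_span_range_iff_exists_fun] at hf
      obtain ⟨g, hg⟩ := hf
      have hΔ : Δ f = ∑ i, φ (X i) • Δ (g i) := by
        rw [← sub_zero (Δ f), ← hC (constantCoeff f), ← map_sub, ← hg, map_sum]
        exact Finset.sum_congr rfl fun i _ => by rw [hmul, hX, smul_zero, zero_add]
      rw [hΔ, pow_succ', mul_smul]
      exact Submodule.sum_mem _ fun i _ => Submodule.smul_mem_smul (hφ i) (ih (g i))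
  refine LinearMap.ext fun f => ?_
  exact IsHausdorff.haus (I := I) ‹_› _ fun N => SModEq.zero.2 (hpow N f)

variable [Fintype σ]

/-- The Euler derivation `∑ Xᵢ ∂/∂Xᵢ` of `k⟦X⟧`, which multiplies forms of degree `j` by `j`. -/
noncomputable def eulerDerivation (k σ : Type*) [Field k] [Fintype σ] :
    Derivation k (MvPowerSeries σ k) (MvPowerSeries σ k) :=
  ∑ i : σ, (X i : MvPowerSeries σ k) • pderiv k i

theorem eulerDerivation_apply (f : MvPowerSeries σ k) :
    eulerDerivation k σ f = ∑ i, X i * pderiv k i f := by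
  simp only [eulerDerivation, ← Derivation.coeFnAddMonoidHom_apply, map_sum, Finset.sum_apply]
  rfl

theorem eulerDerivation_mem_pow_succ {f : MvPowerSeries σ k} {j : ℕ}
    (hf : ∀ i, pderiv k i f ∈ maximalIdeal (MvPowerSeries σ k) ^ j) :
    eulerDerivation k σ f ∈ maximalIdeal (MvPowerSeries σ k) ^ (j + 1) := by
  rw [eulerDerivation_apply, pow_succ']
  exact Ideal.sum_mem _ fun i _ => Ideal.mul_mem_mul (X_mem_maximalIdeal_mvPowerSeries i) (hf i)

theorem eulerDerivation_sub_self_mem_sq {f : MvPowerSeries σ k}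
    (hf : f ∈ maximalIdeal (MvPowerSeries σ k)) :
    eulerDerivation k σ f - f ∈ maximalIdeal (MvPowerSeries σ k) ^ 2 := by
  classical
  rw [← span_range_X_eq_maximalIdeal, Ideal.mem_span_range_iff_exists_fun] at hf
  obtain ⟨g, rfl⟩ := hf
  rw [map_sum, ← Finset.sum_sub_distrib]
  refine Ideal.sum_mem _ fun i _ => ?_
  have hX : eulerDerivation k σ (X i) = X i := by
    simp [eulerDerivation_apply, MvPowerSeries.pderiv_X, Pi.single_apply]
  rw [Derivation.leibniz, hX, smul_eq_mul, smul_eq_mul, add_sub_cancel_left, sq]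
  exact Ideal.mul_mem_mul (X_mem_maximalIdeal_mvPowerSeries i)
    (by simpa using eulerDerivation_mem_pow_succ (f := g i) (j := 0) (by simp))

theorem eulerDerivation_sub_natCast_mul_mem_pow_succ {f : MvPowerSeries σ k} {j : ℕ}
    (hf : f ∈ maximalIdeal (MvPowerSeries σ k) ^ j) :
    eulerDerivation k σ f - j * f ∈ maximalIdeal (MvPowerSeries σ k) ^ (j + 1) := by
  induction j generalizing f with
  | zero => simpa using eulerDerivation_mem_pow_succ (f := f) (j := 0) (by simp)
  | succ j ih =>
    rw [pow_succ] at hf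
    refine Submodule.mul_induction_on hf (fun a ha b hb => ?_) fun a b ha hb => ?_
    · have h1 := Ideal.mul_mem_mul ha (eulerDerivation_sub_self_mem_sq hb)
      have h2 := Ideal.mul_mem_mul (ih ha) hb
      rw [← pow_add] at h1
      rw [← pow_succ] at h2
      convert add_mem h1 h2 using 1
      rw [Derivation.leibniz, smul_eq_mul, smul_eq_mul]
      push_cast
      ring
    · convert add_mem ha hb using 1
      rw [map_add]
      ring

theorem mem_pow_of_eulerDerivation_mem_pow [CharZero k] {f : MvPowerSeries σ k}
    (hf : f ∈ maximalIdeal (MvPowerSeries σ k)) {j : ℕ}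
    (hE : eulerDerivation k σ f ∈ maximalIdeal (MvPowerSeries σ k) ^ (j + 1)) :
    f ∈ maximalIdeal (MvPowerSeries σ k) ^ (j + 1) := by
  induction j with
  | zero => simpa using hf
  | succ j ih =>
    have h := sub_mem hE (eulerDerivation_sub_natCast_mul_mem_pow_succ
      (ih (Ideal.pow_le_pow_right (Nat.le_succ _) hE)))
    rw [sub_sub_cancel, mul_comm] at h
    have hunit : IsUnit ((j + 1 : ℕ) : MvPowerSeries σ k) := by
      simpa using (Nat.cast_ne_zero (R := k).2 j.succ_ne_zero).isUnit.map (C (σ := σ))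
    rwa [Ideal.mul_unit_mem_iff_mem _ hunit] at h

end PowerSeries

section Presentation

open MvPowerSeries (X pderiv)

variable {k R : Type*} [Field k] [CommRing R] [Algebra k R] {N : ℕ}
  {Φ : MvPowerSeries (Fin N) k →ₐ[k] R}

theorem map_mem_maximalIdeal [IsLocalRing R] (hΦ : Function.Surjective Φ)
    {f : MvPowerSeries (Fin N) k} (hf : f ∈ maximalIdeal (MvPowerSeries (Fin N) k)) :
    Φ f ∈ maximalIdeal R := by
  rw [← map_maximalIdeal_of_surjective Φ.toRingHom hΦ]
  exact Ideal.mem_map_of_mem Φ.toRingHom hf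

variable (Φ) in
/-- The Jacobian columns as a `k`-linear map. -/
noncomputable def jacobianMap : MvPowerSeries (Fin N) k →ₗ[k] (Fin N → R) :=
  LinearMap.pi fun i => Φ.toLinearMap ∘ₗ (pderiv k i : MvPowerSeries (Fin N) k →ₗ[k] _)

theorem jacobianMap_apply (f : MvPowerSeries (Fin N) k) : jacobianMap Φ f = jacobianColumn Φ f :=
  rfl

theorem jacobianMap_mul (f g : MvPowerSeries (Fin N) k) :
    jacobianMap Φ (f * g) = Φ f • jacobianMap Φ g + Φ g • jacobianMap Φ f := by
  ext i
  simp [jacobianMap, Derivation.leibniz]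

theorem jacobianMap_X (i : Fin N) : jacobianMap Φ (X i) = Pi.single i 1 := by
  ext j
  simp [jacobianMap, MvPowerSeries.pderiv_X, Pi.single_apply, apply_ite Φ, eq_comm]

namespace UniversallyFiniteDifferentials

theorem mk_jacobianMap_eq {f g : MvPowerSeries (Fin N) k} (h : Φ f = Φ g) :
    (Submodule.Quotient.mk (jacobianMap Φ f) : UniversallyFiniteDifferentials Φ) =
      Submodule.Quotient.mk (jacobianMap Φ g) := by
  rw [Submodule.Quotient.eq, ← map_sub]
  exact Submodule.subset_span ⟨f - g, by simp [h], rfl⟩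

/-- The universal derivation `d : R → Ω`, sending the class of `f` to that of its Jacobian
column. -/
noncomputable def d (hΦ : Function.Surjective Φ) :
    Derivation k R (UniversallyFiniteDifferentials Φ) :=
  Derivation.mk'
    { toFun r := Submodule.Quotient.mk (jacobianMap Φ (Function.surjInv hΦ r))
      map_add' a b := by
        rw [← Submodule.Quotient.mk_add, ← map_add]
        exact mk_jacobianMap_eq (by simp [Function.surjInv_eq hΦ])
      map_smul' c a := by
        rw [RingHom.id_apply, ← Submodule.Quotient.mk_smul, ← map_smul]
        exact mk_jacobianMap_eq (by simp [Function.surjInv_eq hΦ]) }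
    fun a b => by
      simp only [LinearMap.coe_mk, AddHom.coe_mk]
      rw [mk_jacobianMap_eq (g := Function.surjInv hΦ a * Function.surjInv hΦ b)
        (by simp [Function.surjInv_eq hΦ]), jacobianMap_mul, Function.surjInv_eq hΦ,
        Function.surjInv_eq hΦ, Submodule.Quotient.mk_add, Submodule.Quotient.mk_smul,
        Submodule.Quotient.mk_smul]

theorem d_map (hΦ : Function.Surjective Φ) (f : MvPowerSeries (Fin N) k) :
    d hΦ (Φ f) = Submodule.Quotient.mk (jacobianMap Φ f) :=
  mk_jacobianMap_eq (Function.surjInv_eq hΦ _)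

theorem span_range_d (hΦ : Function.Surjective Φ) :
    Submodule.span R (Set.range (d hΦ)) = ⊤ := by
  refine top_unique ?_
  rw [← Submodule.range_mkQ, ← Submodule.map_top, ← (Pi.basisFun R (Fin N)).span_eq,
    Submodule.map_span]
  refine Submodule.span_mono ?_
  rintro _ ⟨_, ⟨i, rfl⟩, rfl⟩
  exact ⟨Φ (X i), by rw [d_map, jacobianMap_X, Pi.basisFun_apply]; rfl⟩

section Lift

variable [IsLocalRing R] {M : Type*} [AddCommGroup M] [Module k M] [Module R M]
  [IsScalarTower k R M] [IsHausdorff (maximalIdeal R) M]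

theorem linearCombination_jacobianMap (hΦ : Function.Surjective Φ) (D : Derivation k R M)
    (f : MvPowerSeries (Fin N) k) :
    Fintype.linearCombination R (fun i => D (Φ (X i))) (jacobianMap Φ f) = D (Φ f) := by
  have hzero : ((Fintype.linearCombination R fun i => D (Φ (X i))).restrictScalars k ∘ₗ
      jacobianMap Φ - D.toLinearMap ∘ₗ Φ.toLinearMap) = 0 := by
    refine eq_zero_of_leibniz_of_apply_X_eq_zero (φ := Φ.toRingHom)
      (fun i => map_mem_maximalIdeal hΦ (X_mem_maximalIdeal_mvPowerSeries i)) (fun f g => ?_)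
      fun i => ?_
    · simp only [LinearMap.sub_apply, LinearMap.coe_comp, LinearMap.coe_restrictScalars,
        Function.comp_apply, jacobianMap_mul, map_add, map_smul, Derivation.coeFn_coe,
        AlgHom.coe_toLinearMap, map_mul, Derivation.leibniz, AlgHom.toRingHom_eq_coe,
        RingHom.coe_coe, smul_sub]
      abel
    · simp [jacobianMap_X]
  exact sub_eq_zero.1 (LinearMap.congr_fun hzero f)

/-- The `R`-linear map `Ω → M` induced by a derivation `R → M`, for `M` separated in the
`𝔪`-adic topology. -/
noncomputable def lift (hΦ : Function.Surjective Φ) (D : Derivation k R M) :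
    UniversallyFiniteDifferentials Φ →ₗ[R] M :=
  Submodule.liftQ _ (Fintype.linearCombination R fun i => D (Φ (X i))) <| by
    rw [Submodule.span_le]
    rintro _ ⟨f, hf, rfl⟩
    rw [SetLike.mem_coe, LinearMap.mem_ker, ← jacobianMap_apply,
      linearCombination_jacobianMap hΦ D, (RingHom.mem_ker ..).1 hf, map_zero]

theorem lift_d (hΦ : Function.Surjective Φ) (D : Derivation k R M) (r : R) :
    lift hΦ D (d hΦ r) = D r := by
  obtain ⟨f, rfl⟩ := hΦ r
  rw [d_map]
  exact linearCombination_jacobianMap hΦ D f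

end Lift

end UniversallyFiniteDifferentials

end Presentation

section Augmentation

variable {k R : Type*} [Field k] [CommRing R] [IsLocalRing R] [Algebra k R] (ε : R →ₐ[k] k)

theorem mem_maximalIdeal_iff_augmentation_eq_zero {r : R} : r ∈ maximalIdeal R ↔ ε r = 0 := by
  rw [← ker_eq_maximalIdeal ε.toRingHom fun c => ⟨algebraMap k R c, ε.commutes c⟩]
  rfl

theorem sub_algebraMap_augmentation_mem (r : R) :
    r - algebraMap k R (ε r) ∈ maximalIdeal R := by
  simp [mem_maximalIdeal_iff_augmentation_eq_zero ε]

include ε in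
theorem algebraMap_residueField_bijective : Function.Bijective (algebraMap k (ResidueField R)) := by
  refine ⟨(algebraMap k (ResidueField R)).injective, fun a => ?_⟩
  obtain ⟨r, rfl⟩ := residue_surjective a
  exact ⟨ε r, (sub_eq_zero.1 ((map_sub (residue R) _ _).symm.trans
    ((residue_eq_zero_iff _).2 (sub_algebraMap_augmentation_mem ε r)))).symm⟩

theorem nonempty_augmentation {N : ℕ} {Φ : MvPowerSeries (Fin N) k →ₐ[k] R}
    (hΦ : Function.Surjective Φ) : Nonempty (R →ₐ[k] k) := by
  have hres : Function.Surjective (algebraMap k (ResidueField R)) := fun a => by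
    obtain ⟨r, rfl⟩ := residue_surjective a
    obtain ⟨f, rfl⟩ := hΦ r
    refine ⟨MvPowerSeries.constantCoeff f, ?_⟩
    have hf := map_mem_maximalIdeal hΦ (sub_C_constantCoeff_mem_maximalIdeal f)
    rw [map_sub, ← residue_eq_zero_iff, map_sub, sub_eq_zero, MvPowerSeries.c_eq_algebraMap,
      AlgHom.commutes] at hf
    exact hf.symm
  exact ⟨(AlgEquiv.ofBijective (Algebra.ofId k (ResidueField R))
    ⟨RingHom.injective _, hres⟩).symm.toAlgHom.comp (IsScalarTower.toAlgHom k R (ResidueField R))⟩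

instance : IsScalarTower k (ResidueField R) (CotangentSpace R) :=
  .to₁₃₄ k R _ _

include ε in
theorem finrank_cotangentSpace_eq_spanFinrank [IsNoetherianRing R] :
    Module.finrank k (CotangentSpace R) = (maximalIdeal R).spanFinrank := by
  have h1 : Module.finrank k (ResidueField R) = 1 := by
    rw [← (AlgEquiv.ofBijective (Algebra.ofId k (ResidueField R))
      (algebraMap_residueField_bijective ε)).toLinearEquiv.finrank_eq, Module.finrank_self]
  rw [spanFinrank_maximalIdeal_eq_finrank_cotangentSpace,
    ← Module.finrank_mul_finrank k (ResidueField R), h1, one_mul]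

include ε in
theorem finite_cotangentSpace [IsNoetherianRing R] :
    Module.Finite k (CotangentSpace R) := by
  have : Module.Finite k (ResidueField R) :=
    .of_surjective (Algebra.ofId k (ResidueField R)).toLinearMap
      (algebraMap_residueField_bijective ε).2
  exact .trans (ResidueField R) _

theorem smul_cotangentSpace (r : R) (v : CotangentSpace R) : r • v = ε r • v := by
  have h := Ideal.Cotangent.smul_eq_zero_of_mem (sub_algebraMap_augmentation_mem ε r) v
  rwa [sub_smul, algebraMap_smul, sub_eq_zero] at h

include ε in
theorem spanFinrank_sub_one_le_finrank_cotangentSpace_quotient [IsNoetherianRing R]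
    (v : CotangentSpace R) :
    (maximalIdeal R).spanFinrank - 1 ≤ Module.finrank k (CotangentSpace R ⧸ R ∙ v) := by
  have hspan : (R ∙ v).restrictScalars k = k ∙ v := by
    ext w
    rw [Submodule.restrictScalars_mem, Submodule.mem_span_singleton, Submodule.mem_span_singleton]
    exact ⟨fun ⟨r, hr⟩ => ⟨ε r, smul_cotangentSpace ε r v ▸ hr⟩,
      fun ⟨c, hc⟩ => ⟨algebraMap k R c, (algebraMap_smul R c v).trans hc⟩⟩
  have := finite_cotangentSpace ε
  rw [← finrank_cotangentSpace_eq_spanFinrank ε,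
    ← (Submodule.Quotient.restrictScalarsEquiv k (R ∙ v)).finrank_eq, hspan]
  exact finrank_sub_one_le_finrank_quotient_span_singleton v

/-- The derivation `r ↦ [r - r(0)]` from `R` to its cotangent space, where `r(0) = ε r`. -/
noncomputable def cotangentDerivation : Derivation k R (CotangentSpace R) :=
  Derivation.mk' ((maximalIdeal R).toCotangent.restrictScalars k ∘ₗ
    LinearMap.codRestrict ((maximalIdeal R).restrictScalars k)
      (LinearMap.id - Algebra.linearMap k R ∘ₗ ε.toLinearMap)
      (sub_algebraMap_augmentation_mem ε)) fun a b => by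
    have hab : a * b - algebraMap k R (ε (a * b)) - (ε a • b + ε b • a -
        algebraMap k R (ε (ε a • b + ε b • a))) =
        (a - algebraMap k R (ε a)) * (b - algebraMap k R (ε b)) := by
      simp only [map_mul, map_add, Algebra.smul_def, AlgHom.commutes, Algebra.algebraMap_self_apply]
      ring
    rw [smul_cotangentSpace ε a, smul_cotangentSpace ε b, ← map_smul, ← map_smul, ← map_add]
    refine (maximalIdeal R).toCotangent_eq.2 ?_
    rw [sq]
    exact hab ▸ Ideal.mul_mem_mul (sub_algebraMap_augmentation_mem ε a)
      (sub_algebraMap_augmentation_mem ε b)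

theorem cotangentDerivation_apply (r : R) : cotangentDerivation ε r =
    (maximalIdeal R).toCotangent ⟨_, sub_algebraMap_augmentation_mem ε r⟩ := rfl

theorem cotangentDerivation_eq_zero_iff {r : R} (hr : r ∈ maximalIdeal R) :
    cotangentDerivation ε r = 0 ↔ r ∈ maximalIdeal R ^ 2 := by
  rw [cotangentDerivation_apply, Ideal.toCotangent_eq_zero]
  simp only [(mem_maximalIdeal_iff_augmentation_eq_zero ε).1 hr, map_zero, sub_zero]

theorem cotangentDerivation_surjective : Function.Surjective (cotangentDerivation ε) := by
  intro v
  obtain ⟨⟨r, hr⟩, rfl⟩ := (maximalIdeal R).toCotangent_surjective v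
  refine ⟨r, ?_⟩
  simp [cotangentDerivation_apply, (mem_maximalIdeal_iff_augmentation_eq_zero ε).1 hr]

end Augmentation

section ExteriorDerivative

open ExteriorAlgebra (ι)

variable {k R V : Type*} [Field k] [CommRing R] [Algebra k R] [AddCommGroup V] [Module k V]
  [Module R V] {ε : R →ₐ[k] k} (δ : Derivation k R V)

/-- The action `r • (v, w) = (r(0) v, r(0) w + δ r ∧ v)` of `R` on `V ⊕ ΛV`, where `r(0) = ε r`.
For this action `r ↦ (δ r, 0)` is a derivation, so that the exterior derivative
`r ds ↦ δ r ∧ δ s` is the second component of an `R`-linear map. -/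
def twistedAction (hV : ∀ (r : R) (v : V), r • v = ε r • v) :
    R →+* Module.End k (V × ExteriorAlgebra k V) where
  toFun r := (ε r • LinearMap.fst k V _).prod
    (ε r • LinearMap.snd k V _ + LinearMap.mulLeft k (ι k (δ r)) ∘ₗ ι k ∘ₗ LinearMap.fst k V _)
  map_one' := by ext <;> simp
  map_zero' := by ext <;> simp
  map_add' a b := by ext <;> simp [add_smul, add_mul]
  map_mul' a b := by ext v <;> simp [mul_smul, hV, add_mul]

theorem twistedAction_apply (hV : ∀ (r : R) (v : V), r • v = ε r • v) (r : R)
    (p : V × ExteriorAlgebra k V) :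
    twistedAction δ hV r p = (ε r • p.1, ε r • p.2 + ι k (δ r) * ι k p.1) := rfl

variable [IsLocalRing R]

theorem twistedAction_eq_zero_of_mem_maximalIdeal_sq
    (hV : ∀ (r : R) (v : V), r • v = ε r • v) {r : R} (hr : r ∈ maximalIdeal R ^ 2) :
    twistedAction δ hV r = 0 := by
  rw [← RingHom.mem_ker]
  refine (sq (maximalIdeal R) ▸ Ideal.mul_le.2 fun a ha b hb => ?_ :
    maximalIdeal R ^ 2 ≤ RingHom.ker (twistedAction δ hV)) hr
  rw [mem_maximalIdeal_iff_augmentation_eq_zero ε] at ha hb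
  rw [RingHom.mem_ker, map_mul]
  ext p <;> simp [twistedAction_apply, ha, hb]

theorem exists_exteriorDerivative {N : ℕ} {Φ : MvPowerSeries (Fin N) k →ₐ[k] R}
    (hV : ∀ (r : R) (v : V), r • v = ε r • v) (hΦ : Function.Surjective Φ) :
    ∃ ψ : UniversallyFiniteDifferentials Φ →ₗ[k] ExteriorAlgebra k V, ∀ r s,
      ψ (r • UniversallyFiniteDifferentials.d hΦ s) = ι k (δ r) * ι k (δ s) := by
  let _ : Module R (V × ExteriorAlgebra k V) := Module.compHom _ (twistedAction δ hV)
  have hsmul (r : R) (p : V × ExteriorAlgebra k V) : r • p = twistedAction δ hV r p := rfl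
  have : IsScalarTower k R (V × ExteriorAlgebra k V) := .of_algebraMap_smul fun c p => by
    ext <;> simp [hsmul, twistedAction_apply]
  have : IsHausdorff (maximalIdeal R) (V × ExteriorAlgebra k V) := ⟨fun p hp => by
    refine (Submodule.smul_le (P := ⊥)).2 (fun r hr q _ => ?_) (SModEq.zero.1 (hp 2))
    simp [hsmul, twistedAction_eq_zero_of_mem_maximalIdeal_sq δ hV hr]⟩
  let D : Derivation k R (V × ExteriorAlgebra k V) :=
    Derivation.mk' (LinearMap.inl k V _ ∘ₗ δ.toLinearMap) fun a b => by
      ext <;> simp [hsmul, twistedAction_apply, hV]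
  refine ⟨LinearMap.snd k V _ ∘ₗ (UniversallyFiniteDifferentials.lift hΦ D).restrictScalars k,
    fun r s => ?_⟩
  have hD : UniversallyFiniteDifferentials.lift hΦ D (UniversallyFiniteDifferentials.d hΦ s) =
      (δ s, 0) := UniversallyFiniteDifferentials.lift_d hΦ D s
  simp [hD, hsmul, twistedAction_apply]

end ExteriorDerivative

section CotangentExterior

open UniversallyFiniteDifferentials (d lift lift_d span_range_d)

variable {k R : Type*} [Field k] [CommRing R] [Algebra k R] {N : ℕ}
  {Φ : MvPowerSeries (Fin N) k →ₐ[k] R} {hΦ : Function.Surjective Φ}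

theorem exteriorPower_two_le_range {V : Type*} [AddCommGroup V] [Module k V] {δ : R → V}
    (hδ : Function.Surjective δ)
    {ψ : UniversallyFiniteDifferentials Φ →ₗ[k] ExteriorAlgebra k V}
    (hψ : ∀ r s, ψ (r • d hΦ s) = ExteriorAlgebra.ι k (δ r) * ExteriorAlgebra.ι k (δ s)) :
    ⋀[k]^2 V ≤ ψ.range := by
  rw [ExteriorAlgebra.exteriorPower, sq, Submodule.mul_le]
  rintro _ ⟨v, rfl⟩ _ ⟨w, rfl⟩
  obtain ⟨r, rfl⟩ := hδ v
  obtain ⟨s, rfl⟩ := hδ w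
  exact ⟨_, hψ r s⟩

theorem apply_smul_eq_zero_of_apply_smul_smul_d_eq_zero {M : Type*} [AddCommGroup M] [Module k M]
    {ψ : UniversallyFiniteDifferentials Φ →ₗ[k] M} {x : R}
    (hψ : ∀ r s : R, ψ (x • r • d hΦ s) = 0) (ω : UniversallyFiniteDifferentials Φ) :
    ψ (x • ω) = 0 := by
  have hω : ω ∈ Submodule.span R (Set.range (d hΦ)) := span_range_d hΦ ▸ Submodule.mem_top
  suffices ∀ r : R, ψ (x • r • ω) = 0 by simpa using this 1
  induction hω using Submodule.span_induction with
  | mem _ h => obtain ⟨s, rfl⟩ := h; exact fun r => hψ r s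
  | zero => simp
  | add _ _ _ _ h₁ h₂ => simp_all [smul_add]
  | smul a _ _ h => exact fun r => by rw [smul_smul r a]; exact h _

variable [IsLocalRing R]

theorem exists_relativeExteriorDerivative (hΦ : Function.Surjective Φ) (ε : R →ₐ[k] k)
    {x : R} (hx : x ∈ maximalIdeal R) :
    ∃ ψ : UniversallyFiniteDifferentials Φ →ₗ[k]
        ExteriorAlgebra k (CotangentSpace R ⧸ R ∙ cotangentDerivation ε x),
      (∀ r, ψ (d hΦ r) = 0) ∧ (∀ ω (a : R), ψ (x • ω + a • d hΦ x) = 0) ∧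
      ⋀[k]^2 (CotangentSpace R ⧸ R ∙ cotangentDerivation ε x) ≤ ψ.range := by
  let v := cotangentDerivation ε x
  let δ : Derivation k R (CotangentSpace R ⧸ R ∙ v) :=
    (R ∙ v).mkQ.compDer (cotangentDerivation ε)
  have hδ : Function.Surjective δ :=
    (R ∙ v).mkQ_surjective.comp (cotangentDerivation_surjective ε)
  have hδx : δ x = 0 := (Submodule.Quotient.mk_eq_zero _).2 (Submodule.mem_span_singleton_self v)
  have hV (r : R) (w : CotangentSpace R ⧸ R ∙ v) : r • w = ε r • w := by
    obtain ⟨w, rfl⟩ := (R ∙ v).mkQ_surjective w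
    exact congrArg (R ∙ v).mkQ (smul_cotangentSpace ε r w)
  obtain ⟨ψ, hψ⟩ := exists_exteriorDerivative δ hV hΦ
  refine ⟨ψ, fun r => by simpa using hψ 1 r, fun ω a => ?_, exteriorPower_two_le_range hδ hψ⟩
  rw [map_add, hψ a x, hδx, map_zero, mul_zero, add_zero]
  refine apply_smul_eq_zero_of_apply_smul_smul_d_eq_zero (hΦ := hΦ) (fun r s => ?_) ω
  rw [smul_smul, hψ, δ.leibniz, hδx, smul_zero, add_zero, hV,
    (mem_maximalIdeal_iff_augmentation_eq_zero ε).1 hx, zero_smul, map_zero, zero_mul]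

theorem mem_maximalIdeal_sq_of_d_eq_smul [IsNoetherianRing R] (hΦ : Function.Surjective Φ)
    {x : R} (hx : x ∈ maximalIdeal R) {ω : UniversallyFiniteDifferentials Φ}
    (hω : d hΦ x = x • ω) : x ∈ maximalIdeal R ^ 2 := by
  obtain ⟨ε⟩ := nonempty_augmentation hΦ
  have : Module.Finite R (CotangentSpace R) :=
    .of_surjective _ (maximalIdeal R).toCotangent_surjective
  have hlift := congrArg (lift hΦ (cotangentDerivation ε)) hω
  rw [lift_d, map_smul] at hlift
  exact (cotangentDerivation_eq_zero_iff ε hx).1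
    (hlift.trans (Ideal.Cotangent.smul_eq_zero_of_mem hx _))

end CotangentExterior

section ExactDifferentials

open MvPowerSeries (C X constantCoeff pderiv)
open UniversallyFiniteDifferentials (d d_map lift lift_d linearCombination_jacobianMap)

variable {k R : Type*} [Field k] [CommRing R] [Algebra k R] {N : ℕ}
  {Φ : MvPowerSeries (Fin N) k →ₐ[k] R}

theorem exists_jacobianMap_eq_of_mem_span (hΦ : Function.Surjective Φ) {v : Fin N → R}
    (hv : v ∈ Submodule.span R (jacobianColumn Φ '' RingHom.ker Φ)) :
    ∃ g, Φ g = 0 ∧ jacobianMap Φ g = v := by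
  induction hv using Submodule.span_induction with
  | mem _ h => exact h
  | zero => exact ⟨0, map_zero _, map_zero _⟩
  | add v w _ _ hv hw =>
    obtain ⟨f, hf, rfl⟩ := hv
    obtain ⟨g, hg, rfl⟩ := hw
    exact ⟨f + g, by rw [map_add, hf, hg, add_zero], map_add _ _ _⟩
  | smul r v _ hv =>
    obtain ⟨g, hg, rfl⟩ := hv
    obtain ⟨f, rfl⟩ := hΦ r
    exact ⟨f * g, by rw [map_mul, hg, mul_zero], by rw [jacobianMap_mul, hg, zero_smul, add_zero]⟩

theorem exists_map_eq_and_jacobianMap_eq_zero (hΦ : Function.Surjective Φ) {r : R}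
    (hr : d hΦ r = 0) : ∃ f, Φ f = r ∧ jacobianMap Φ f = 0 := by
  obtain ⟨f, rfl⟩ := hΦ r
  rw [d_map, Submodule.Quotient.mk_eq_zero] at hr
  obtain ⟨g, hg, hgf⟩ := exists_jacobianMap_eq_of_mem_span hΦ hr
  exact ⟨f - g, by rw [map_sub, hg, sub_zero], by rw [map_sub, hgf, sub_self]⟩

variable [IsLocalRing R]

theorem ker_le_maximalIdeal_sq [IsNoetherianRing R] (hΦ : Function.Surjective Φ)
    (hN : N = (maximalIdeal R).spanFinrank) :
    RingHom.ker Φ ≤ maximalIdeal (MvPowerSeries (Fin N) k) ^ 2 := by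
  obtain ⟨ε⟩ := nonempty_augmentation hΦ
  have : Module.Finite R (CotangentSpace R) :=
    .of_surjective _ (maximalIdeal R).toCotangent_surjective
  have := finite_cotangentSpace ε
  let b (i : Fin N) : CotangentSpace R := cotangentDerivation ε (Φ (X i))
  have hb (f : MvPowerSeries (Fin N) k) :
      ∑ i, ε (Φ (pderiv k i f)) • b i = cotangentDerivation ε (Φ f) := by
    simp only [← linearCombination_jacobianMap hΦ (cotangentDerivation ε) f, ← smul_cotangentSpace]
    rfl
  have hspan : ⊤ ≤ Submodule.span k (Set.range b) := fun v _ => by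
    obtain ⟨r, rfl⟩ := cotangentDerivation_surjective ε v
    obtain ⟨f, rfl⟩ := hΦ r
    exact hb f ▸ sum_mem fun i _ => Submodule.smul_mem _ _ (Submodule.subset_span ⟨i, rfl⟩)
  have hli : LinearIndependent k b := by
    refine linearIndependent_of_top_le_span_of_card_eq_finrank hspan ?_
    rw [Fintype.card_fin, finrank_cotangentSpace_eq_spanFinrank ε, hN]
  have hmem {f : MvPowerSeries (Fin N) k} (hf : ε (Φ f) = 0) :
      f ∈ maximalIdeal (MvPowerSeries (Fin N) k) := fun hunit =>
    not_isUnit_zero (hf ▸ (hunit.map Φ).map ε)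
  intro f hf
  have hf0 : Φ f = 0 := hf
  have hpderiv (i) : pderiv k i f ∈ maximalIdeal (MvPowerSeries (Fin N) k) ^ 1 := by
    rw [pow_one]
    exact hmem (Fintype.linearIndependent_iff.1 hli _ ((hb f).trans (by simp [hf0])) i)
  have hE := eulerDerivation_mem_pow_succ hpderiv
  exact (Submodule.sub_mem_iff_right _ hE).1
    (eulerDerivation_sub_self_mem_sq (hmem (by simp [hf0])))

theorem mem_range_algebraMap_of_d_eq_zero [CharZero k] (hΦ : Function.Surjective Φ)
    (hker : RingHom.ker Φ ≤ maximalIdeal (MvPowerSeries (Fin N) k) ^ 2)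
    (hbot : maximalIdeal R ^ 4 = ⊥) {r : R} (hr : d hΦ r = 0) :
    r ∈ Set.range (algebraMap k R) := by
  obtain ⟨f, rfl, hf⟩ := exists_map_eq_and_jacobianMap_eq_zero hΦ hr
  have hpderiv (i) : Φ (pderiv k i f) = 0 := congrFun hf i
  set g := f - C (constantCoeff f) with hg
  have hgf (i) : pderiv k i g = pderiv k i f := by
    rw [hg, map_sub, MvPowerSeries.c_eq_algebraMap, Derivation.map_algebraMap, sub_zero]
  have hg₃ : g ∈ maximalIdeal (MvPowerSeries (Fin N) k) ^ 3 :=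
    mem_pow_of_eulerDerivation_mem_pow (sub_C_constantCoeff_mem_maximalIdeal f)
      (eulerDerivation_mem_pow_succ fun i => hker ((congrArg Φ (hgf i)).trans (hpderiv i)))
  have hΦE : Φ (eulerDerivation k (Fin N) g) = 0 := by
    simp [eulerDerivation_apply, hgf, hpderiv]
  have hΦ₄ : Φ (eulerDerivation k (Fin N) g - (3 : ℕ) * g) ∈ maximalIdeal R ^ 4 := by
    rw [← map_maximalIdeal_of_surjective Φ.toRingHom hΦ, ← Ideal.map_pow]
    exact Ideal.mem_map_of_mem Φ.toRingHom (eulerDerivation_sub_natCast_mul_mem_pow_succ hg₃)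
  have hΦg : (3 : k) • Φ g = 0 := by
    rw [hbot, Ideal.mem_bot, map_sub, hΦE, zero_sub, neg_eq_zero, map_mul, map_natCast] at hΦ₄
    simpa [Algebra.smul_def, map_ofNat] using hΦ₄
  have hΦg₀ : Φ g = 0 := (smul_eq_zero.1 hΦg).resolve_left three_ne_zero
  refine ⟨constantCoeff f, ?_⟩
  rwa [hg, map_sub, MvPowerSeries.c_eq_algebraMap, Φ.commutes, sub_eq_zero, eq_comm] at hΦg₀

theorem exists_sub_algebraMap_mem_of_d_eq [IsNoetherianRing R] [CharZero k]
    (hΦ : Function.Surjective Φ) {b : Ideal R} (hb : maximalIdeal R ^ 4 ≤ b) {x : R} (hx : x ∈ b)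
    {r a : R} {ω : UniversallyFiniteDifferentials Φ} (h : d hΦ r = x • ω + a • d hΦ x) :
    ∃ c : k, r - algebraMap k R c ∈ b := by
  rcases eq_or_ne b ⊤ with rfl | htop
  · exact ⟨0, Submodule.mem_top⟩
  have : Nontrivial (R ⧸ b) := Ideal.Quotient.nontrivial_iff.2 htop
  have := IsLocalRing.of_surjective' (Ideal.Quotient.mk b) Ideal.Quotient.mk_surjective
  have hbot : maximalIdeal (R ⧸ b) ^ 4 = ⊥ := by
    rw [← map_maximalIdeal_of_surjective _ (Ideal.Quotient.mk_surjective (I := b)),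
      ← Ideal.map_pow, Ideal.map_eq_bot_iff_le_ker, Ideal.mk_ker]
    exact hb
  have := (isArtinianRing_iff_isNilpotent_maximalIdeal (R ⧸ b)).2 ⟨4, hbot⟩
  obtain ⟨ε⟩ := nonempty_augmentation
    (Φ := (Ideal.Quotient.mkₐ k b).comp Φ) (Ideal.Quotient.mk_surjective.comp hΦ)
  obtain ⟨Ψ, hΨ⟩ := exists_surjective_mvPowerSeries k (R ⧸ b) (algebraMap_residueField_bijective ε)
  have hzero {y : R} (hy : y ∈ b) : algebraMap R (R ⧸ b) y = 0 :=
    Ideal.Quotient.eq_zero_iff_mem.2 hy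
  have hsmul (w : UniversallyFiniteDifferentials Ψ) : x • w = 0 := by
    rw [← algebraMap_smul (R ⧸ b), hzero hx, zero_smul]
  have hd := congrArg (lift hΦ ((d hΨ).compAlgebraMap R)) h
  simp only [map_add, map_smul, lift_d, hsmul, Derivation.compAlgebraMap_apply, hzero hx,
    map_zero, smul_zero, add_zero] at hd
  obtain ⟨c, hc⟩ := mem_range_algebraMap_of_d_eq_zero hΨ (ker_le_maximalIdeal_sq hΨ rfl) hbot hd
  exact ⟨c, Ideal.Quotient.eq.1 hc.symm⟩

end ExactDifferentials

section Constants

theorem isPrecomplete_of_finite {A M : Type*} [CommRing A] {I : Ideal A} [IsPrecomplete I A]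
    [AddCommGroup M] [Module A M] [Module.Finite A M] : IsPrecomplete I M := by
  refine AdicCompletion.of_surjective_iff.1 fun u => ?_
  obtain ⟨t, rfl⟩ := AdicCompletion.ofTensorProduct_surjective_of_finite I M u
  induction t with
  | zero => exact ⟨0, by simp⟩
  | add _ _ h₁ h₂ =>
    obtain ⟨m₁, h₁⟩ := h₁
    obtain ⟨m₂, h₂⟩ := h₂
    exact ⟨m₁ + m₂, by rw [map_add, map_add, h₁, h₂]⟩
  | tmul a m =>
    obtain ⟨a, rfl⟩ := AdicCompletion.of_surjective I A a
    exact ⟨a • m, by rw [AdicCompletion.ofTensorProduct_tmul, map_smul]; rfl⟩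

theorem finite_of_finite_quotient_smul_top {A M : Type*} [CommRing A] {I : Ideal A}
    [IsPrecomplete I A] [AddCommGroup M] [Module A M] [IsHausdorff I M]
    [Module.Finite A (M ⧸ I • (⊤ : Submodule A M))] : Module.Finite A M := by
  obtain ⟨e, f, hf⟩ := Module.Finite.exists_fin' A (M ⧸ I • (⊤ : Submodule A M))
  obtain ⟨g, rfl⟩ := Module.projective_lifting_property (I • ⊤ : Submodule A M).mkQ f
    (Submodule.mkQ_surjective _)
  have : IsPrecomplete I (Fin e → A) := isPrecomplete_of_finite
  exact .of_surjective g (surjective_of_mkQ_comp_surjective hf)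

theorem derivation_apply_eq_zero_of_isIntegral {A B V : Type*} [CommRing A] [Algebra ℚ A]
    [CommRing B] [IsDomain B] [Algebra A B] [AddCommGroup V] [Module A V] [Module B V]
    [Module.IsTorsionFree B V] (δ : Derivation A B V) {b : B} (hb : IsIntegral A b) :
    δ b = 0 := by
  have : Nontrivial A := (algebraMap A B).domain_nontrivial
  have hpos : 0 < (minpoly A b).natDegree := minpoly.natDegree_pos hb
  have hlead : algebraMap ℚ A ((minpoly A b).natDegree : ℚ)⁻¹ * (minpoly A b).natDegree = 1 := by
    rw [← map_natCast (algebraMap ℚ A), ← map_mul, inv_mul_cancel₀ (by positivity), map_one]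
  -- In characteristic zero the derivative of a monic polynomial is monic up to a unit.
  have hder : Polynomial.aeval b (minpoly A b).derivative ≠ 0 := fun h => by
    refine (minpoly.min A b (p := algebraMap ℚ A ((minpoly A b).natDegree : ℚ)⁻¹ •
      (minpoly A b).derivative) ?_ (by rw [map_smul, h, smul_zero])).not_gt ?_
    · refine Polynomial.monic_of_natDegree_le_of_coeff_eq_one ((minpoly A b).natDegree - 1)
        ((Polynomial.natDegree_smul_le _ _).trans (Polynomial.natDegree_derivative_le _)) ?_
      rw [Polynomial.coeff_smul, smul_eq_mul, Polynomial.coeff_derivative, Nat.sub_add_cancel hpos,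
        (minpoly.monic hb).coeff_natDegree, one_mul, ← Nat.cast_add_one, Nat.sub_add_cancel hpos,
        hlead]
    · exact (Polynomial.degree_smul_le _ _).trans_lt
        (Polynomial.degree_derivative_lt (minpoly.ne_zero hb))
  have hδ := δ.map_aeval (minpoly A b) b
  rw [minpoly.aeval, map_zero] at hδ
  exact (smul_eq_zero.1 hδ.symm).resolve_left hder

variable {k R : Type*} [Field k] [CommRing R] [IsLocalRing R] [Algebra k R]

theorem exists_powerSeries_algHom_apply_X {N : ℕ} {Φ : MvPowerSeries (Fin N) k →ₐ[k] R}
    (hΦ : Function.Surjective Φ) {x : R} (hx : x ∈ maximalIdeal R) :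
    ∃ φ : PowerSeries k →ₐ[k] R, φ PowerSeries.X = x := by
  obtain ⟨ξ, rfl⟩ := hΦ x
  have hξ : MvPowerSeries.constantCoeff ξ = 0 :=
    mem_maximalIdeal_mvPowerSeries.1 fun hunit => hx (hunit.map Φ)
  have hsubst := PowerSeries.HasSubst.of_constantCoeff_zero hξ
  exact ⟨Φ.comp (PowerSeries.substAlgHom hsubst), by
    rw [AlgHom.comp_apply, PowerSeries.coe_substAlgHom, PowerSeries.subst_X hsubst]⟩

theorem finite_powerSeries [IsNoetherianRing R] [Algebra (PowerSeries k) R]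
    [IsScalarTower k (PowerSeries k) R]
    (hX : algebraMap (PowerSeries k) R PowerSeries.X ∈ maximalIdeal R)
    [Module.Finite k (R ⧸ Ideal.span {algebraMap (PowerSeries k) R PowerSeries.X})] :
    Module.Finite (PowerSeries k) R := by
  have hmap : (Ideal.span {PowerSeries.X}).map (algebraMap (PowerSeries k) R) =
      Ideal.span {algebraMap (PowerSeries k) R PowerSeries.X} := by
    rw [Ideal.map_span, Set.image_singleton]
  have : IsHausdorff (Ideal.span {(PowerSeries.X : PowerSeries k)}) R := by
    rw [← IsHausdorff.map_algebraMap_iff (S := R), hmap]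
    exact .of_le_jacobson _ _ (((Ideal.span_singleton_le_iff_mem _).2 hX).trans
      (maximalIdeal_le_jacobson _))
  have : Module.Finite (PowerSeries k)
      (R ⧸ Ideal.span {(PowerSeries.X : PowerSeries k)} • (⊤ : Submodule (PowerSeries k) R)) := by
    rw [Ideal.smul_top_eq_map, hmap]
    have : Module.Finite (PowerSeries k)
        (R ⧸ Ideal.span {algebraMap (PowerSeries k) R PowerSeries.X}) :=
      .of_restrictScalars_finite k _ _
    exact this
  exact finite_of_finite_quotient_smul_top (I := Ideal.span {(PowerSeries.X : PowerSeries k)})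

theorem derivation_eq_zero_of_apply_eq_zero [IsDomain R] [IsNoetherianRing R] [CharZero k]
    {V : Type*} [AddCommGroup V] [Module k V] [Module R V] [IsScalarTower k R V]
    [Module.Finite R V] [Module.IsTorsionFree R V] {N : ℕ}
    {Φ : MvPowerSeries (Fin N) k →ₐ[k] R} (hΦ : Function.Surjective Φ) {x : R}
    (hx : x ∈ maximalIdeal R) [Module.Finite k (R ⧸ Ideal.span {x})] {δ : Derivation k R V}
    (hδ : δ x = 0) : δ = 0 := by
  obtain ⟨φ, rfl⟩ := exists_powerSeries_algHom_apply_X hΦ hx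
  have hconst : (δ : R →ₗ[k] V) ∘ₗ φ.toLinearMap = 0 :=
    eq_zero_of_leibniz_of_apply_X_eq_zero (I := maximalIdeal R) (φ := (φ : PowerSeries k →+* R))
      (fun _ => hx) (fun f g => by simp) (fun _ => hδ)
  let : Algebra (PowerSeries k) R := φ.toAlgebra
  let : Module (PowerSeries k) V := .compHom V (φ : PowerSeries k →+* R)
  have : IsScalarTower k (PowerSeries k) R := .of_algebraMap_eq fun c => (φ.commutes c).symm
  have : IsScalarTower (PowerSeries k) R V := ⟨fun f r v => mul_smul (φ f) r v⟩
  have : Module.Finite (PowerSeries k) R := finite_powerSeries hx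
  let δ' : Derivation (PowerSeries k) R V := .mk'
    { toFun := δ
      map_add' := map_add δ
      map_smul' := fun f r => by
        have hf : δ (φ f) = 0 := LinearMap.congr_fun hconst f
        rw [Algebra.smul_def, δ.leibniz, show algebraMap (PowerSeries k) R f = φ f from rfl, hf,
          smul_zero, add_zero]
        rfl } δ.leibniz
  ext r
  exact derivation_apply_eq_zero_of_isIntegral δ' (IsIntegral.of_finite (PowerSeries k) r)

end Constants

section FiniteLength

variable {k R Y : Type*} [Field k] [CommRing R] [IsLocalRing R] [Algebra k R]
  [AddCommGroup Y] [Module k Y] [Module R Y] [IsScalarTower k R Y]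

theorem finite_of_maximalIdeal_smul_eq_zero [Module.Finite R Y] (ε : R →ₐ[k] k)
    (h : ∀ r ∈ maximalIdeal R, ∀ y : Y, r • y = 0) : Module.Finite k Y := by
  obtain ⟨s, hs⟩ := Module.Finite.fg_top (R := R) (M := Y)
  refine ⟨⟨s, Submodule.eq_top_iff'.2 fun y => ?_⟩⟩
  induction hs ▸ Submodule.mem_top (R := R) (x := y) using Submodule.span_induction with
  | mem y hy => exact Submodule.subset_span hy
  | zero => exact zero_mem _
  | add _ _ _ _ h₁ h₂ => exact add_mem h₁ h₂
  | smul r y _ hy =>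
    have hr := h _ (sub_algebraMap_augmentation_mem ε r) y
    rw [sub_smul, algebraMap_smul, sub_eq_zero] at hr
    exact hr ▸ Submodule.smul_mem _ _ hy

theorem finite_of_pow_maximalIdeal_smul_eq_zero [IsNoetherianRing R] [Module.Finite R Y]
    (ε : R →ₐ[k] k) {N : ℕ} (h : ∀ r ∈ maximalIdeal R ^ N, ∀ y : Y, r • y = 0) :
    Module.Finite k Y := by
  induction N generalizing Y with
  | zero =>
    have : Subsingleton Y := subsingleton_of_forall_eq 0 fun y => by simpa using h 1 (by simp) y
    infer_instance
  | succ N ih =>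
    let P : Submodule R Y := maximalIdeal R • ⊤
    have hP : Module.Finite k P := ih fun r hr y => Subtype.ext <| by
      refine Submodule.smul_induction_on (p := fun y => r • y = 0) y.2 (fun a ha y _ => ?_)
        fun y z hy hz => by rw [smul_add, hy, hz, add_zero]
      rw [smul_smul]
      exact h _ (Ideal.mul_mem_mul hr ha) y
    have hQ : Module.Finite k (Y ⧸ P) := finite_of_maximalIdeal_smul_eq_zero ε fun r hr y => by
      obtain ⟨y, rfl⟩ := Submodule.Quotient.mk_surjective _ y
      exact (Submodule.Quotient.mk_eq_zero _).2 (Submodule.smul_mem_smul hr trivial)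
    exact @Module.Finite.of_submodule_quotient k Y _ _ _ (P.restrictScalars k) hP hQ

end FiniteLength

section DimensionOne

theorem maximalIdeal_ne_bot_of_ringKrullDim_eq_one {R : Type*} [CommRing R] [IsLocalRing R]
    (hdim : ringKrullDim R = 1) : maximalIdeal R ≠ ⊥ := fun h =>
  one_ne_zero (hdim.symm.trans (ringKrullDim_eq_zero_of_isField (isField_iff_maximalIdeal_eq.2 h)))

variable {R : Type*} [CommRing R] [IsDomain R] [IsLocalRing R] [IsNoetherianRing R]

theorem exists_maximalIdeal_pow_le_span_singleton (hdim : ringKrullDim R = 1) {r : R}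
    (hr : r ≠ 0) : ∃ N : ℕ, maximalIdeal R ^ N ≤ Ideal.span {r} := by
  have hle : Ring.KrullDimLE 1 R := Ring.krullDimLE_iff.2 hdim.le
  obtain ⟨N, hN⟩ := Ideal.exists_radical_pow_le_of_fg (Ideal.span {r}) (IsNoetherian.noetherian _)
  refine ⟨N, (Ideal.pow_right_mono ?_ N).trans hN⟩
  rw [Ideal.radical_eq_sInf]
  refine le_sInf fun P ⟨hP, hprime⟩ => ?_
  have hP0 : P ≠ ⊥ := by
    rintro rfl
    exact hr (by simpa using hP)
  exact (eq_maximalIdeal (Ring.krullDimLE_one_iff_of_noZeroDivisors.1 hle P hP0 hprime)).ge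

theorem exists_maximalIdeal_pow_smul_eq_zero {Y : Type*} [AddCommGroup Y] [Module R Y]
    [Module.Finite R Y] (hdim : ringKrullDim R = 1) (hY : Module.IsTorsion R Y) :
    ∃ N : ℕ, ∀ r ∈ maximalIdeal R ^ N, ∀ y : Y, r • y = 0 := by
  obtain ⟨s, hs, hs'⟩ := Submodule.annihilator_top_inter_nonZeroDivisors hY
  obtain ⟨N, hN⟩ := exists_maximalIdeal_pow_le_span_singleton hdim (nonZeroDivisors.ne_zero hs')
  refine ⟨N, fun r hr y => ?_⟩
  obtain ⟨a, rfl⟩ := Ideal.mem_span_singleton'.1 (hN hr)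
  rw [mul_smul, Submodule.mem_annihilator.1 hs y trivial, smul_zero]

theorem finite_quotient_span_singleton {k : Type*} [Field k] [Algebra k R] (ε : R →ₐ[k] k)
    (hdim : ringKrullDim R = 1) {x : R} (hx : x ≠ 0) :
    Module.Finite k (R ⧸ Ideal.span {x}) := by
  obtain ⟨N, hN⟩ := exists_maximalIdeal_pow_le_span_singleton hdim hx
  refine finite_of_pow_maximalIdeal_smul_eq_zero ε (N := N) fun r hr y => ?_
  rw [Algebra.smul_def, Ideal.Quotient.algebraMap_eq, Ideal.Quotient.eq_zero_iff_mem.2 (hN hr),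
    zero_mul]

theorem IsReductionOf.notMem_maximalIdeal_sq {x : R} (hdim : ringKrullDim R = 1)
    (hx : IsReductionOf (Ideal.span {x}) (maximalIdeal R)) : x ∉ maximalIdeal R ^ 2 := by
  intro hx2
  obtain ⟨-, r, hr⟩ := hx
  have hbot : maximalIdeal R ^ (r + 1) = ⊥ := by
    refine Submodule.eq_bot_of_le_smul_of_le_jacobson_bot (maximalIdeal R) _
      (IsNoetherian.noetherian _) ?_ (maximalIdeal_le_jacobson _)
    calc maximalIdeal R ^ (r + 1) = Ideal.span {x} * maximalIdeal R ^ r := hr.symm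
      _ ≤ maximalIdeal R ^ 2 * maximalIdeal R ^ r :=
        Ideal.mul_mono_left ((Ideal.span_singleton_le_iff_mem _).2 hx2)
      _ = maximalIdeal R • maximalIdeal R ^ (r + 1) := by rw [smul_eq_mul]; ring
  exact maximalIdeal_ne_bot_of_ringKrullDim_eq_one hdim (eq_zero_of_pow_eq_zero hbot)

end DimensionOne

section TorsionQuotient

open scoped Pointwise

variable {k R M : Type*} [Field k] [CommRing R] [Algebra k R]
  [AddCommGroup M] [Module k M] [Module R M] [IsScalarTower k R M]

theorem mk_mk_eq_zero_iff {x : R} {ω m : M} :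
    (Submodule.Quotient.mk (Submodule.Quotient.mk m : M ⧸ R ∙ ω) :
      QuotSMulTop x (M ⧸ R ∙ ω)) = 0 ↔ ∃ (m' : M) (a : R), m = x • m' + a • ω := by
  rw [Submodule.Quotient.mk_eq_zero, Submodule.mem_smul_pointwise_iff_exists]
  constructor
  · rintro ⟨y, -, hy⟩
    obtain ⟨m', rfl⟩ := Submodule.Quotient.mk_surjective _ y
    rw [← Submodule.Quotient.mk_smul, eq_comm, Submodule.Quotient.eq,
      Submodule.mem_span_singleton] at hy
    obtain ⟨a, ha⟩ := hy
    exact ⟨m', a, by rw [ha]; abel⟩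
  · rintro ⟨m', a, rfl⟩
    refine ⟨Submodule.Quotient.mk m', trivial, ?_⟩
    rw [← Submodule.Quotient.mk_smul, eq_comm, Submodule.Quotient.eq, add_sub_cancel_left]
    exact Submodule.smul_mem _ _ (Submodule.mem_span_singleton_self ω)

theorem finrank_map_add_finrank_quotient {a b : Ideal R} (hab : a ≤ b)
    [Module.Finite k (R ⧸ a)] :
    Module.finrank k (b.map (Ideal.Quotient.mk a)) + Module.finrank k (R ⧸ b) =
      Module.finrank k (R ⧸ a) := by
  rw [← (DoubleQuot.quotQuotEquivQuotOfLEₐ k hab).toLinearEquiv.finrank_eq, add_comm]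
  exact ((b.map (Ideal.Quotient.mk a)).restrictScalars k).finrank_quotient_add_finrank

theorem finrank_quotSMulTop_eq_finrank_ker_lsmul [Module.Finite k M] (x : R) :
    Module.finrank k (QuotSMulTop x M) =
      Module.finrank k ((LinearMap.lsmul R M x).restrictScalars k).ker := by
  have h : (x • (⊤ : Submodule R M)).restrictScalars k =
      ((LinearMap.lsmul R M x).restrictScalars k).range :=
    Submodule.ext fun y => by simp [Submodule.mem_smul_pointwise_iff_exists]
  rw [← finrank_quotient_range_eq_finrank_ker, ← h]
  exact (Submodule.Quotient.restrictScalarsEquiv k _).finrank_eq.symm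

theorem finrank_quotSMulTop_quotient_lt [IsDomain R] [Module.IsTorsionFree R M] {x : R}
    (hx : x ≠ 0) {ω : M} (hω : ∀ m : M, ω ≠ x • m) [Module.Finite k (M ⧸ R ∙ ω)]
    [Module.Finite k (R ⧸ Ideal.span {x})] :
    Module.finrank k (QuotSMulTop x (M ⧸ R ∙ ω)) < Module.finrank k (R ⧸ Ideal.span {x}) := by
  -- `x`-torsion classes `m` of `M ⧸ R ∙ ω` correspond to `r` modulo `x` with `r • ω = x • m`.
  let P : Submodule R (M × R) := (LinearMap.lsmul R M x ∘ₗ LinearMap.fst R M R -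
    LinearMap.toSpanSingleton R M ω ∘ₗ LinearMap.snd R M R).ker
  have mem_P {p : M × R} : p ∈ P ↔ x • p.1 = p.2 • ω := by
    simp [P, sub_eq_zero]
  let f : P →ₗ[k] R ⧸ Ideal.span {x} :=
    ((Ideal.span {x}).mkQ ∘ₗ LinearMap.snd R M R ∘ₗ P.subtype).restrictScalars k
  let g : P →ₗ[k] M ⧸ R ∙ ω :=
    ((R ∙ ω).mkQ ∘ₗ LinearMap.fst R M R ∘ₗ P.subtype).restrictScalars k
  have hg : ((LinearMap.lsmul R (M ⧸ R ∙ ω) x).restrictScalars k).ker ≤ g.range := fun y hy => by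
    obtain ⟨m, rfl⟩ := Submodule.Quotient.mk_surjective _ y
    obtain ⟨r, hr⟩ := Submodule.mem_span_singleton.1 ((Submodule.Quotient.mk_eq_zero _).1 hy)
    exact ⟨⟨(m, r), mem_P.2 hr.symm⟩, rfl⟩
  have hfg : f.ker ≤ g.ker := by
    rintro ⟨⟨m, r⟩, hp⟩ hr
    obtain ⟨a, rfl⟩ := Ideal.mem_span_singleton.1 ((Submodule.Quotient.mk_eq_zero _).1 hr)
    rw [mem_P, mul_smul] at hp
    exact (Submodule.Quotient.mk_eq_zero _).2
      (Submodule.mem_span_singleton.2 ⟨a, (smul_right_injective M hx hp).symm⟩)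
  have hf : f.range ≠ ⊤ := fun htop => by
    obtain ⟨⟨⟨m, r⟩, hp⟩, hr⟩ := htop ▸ Submodule.mem_top (x := (1 : R ⧸ Ideal.span {x}))
    obtain ⟨a, ha : r - 1 = x * a⟩ := Ideal.mem_span_singleton.1
      (Ideal.Quotient.eq.1 (hr : Ideal.Quotient.mk _ r = Ideal.Quotient.mk _ 1))
    refine hω (m - a • ω) ?_
    rw [smul_sub, mem_P.1 hp, smul_smul, ← ha, ← sub_smul, sub_sub_cancel, one_smul]
  calc Module.finrank k (QuotSMulTop x (M ⧸ R ∙ ω)) = _ :=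
        finrank_quotSMulTop_eq_finrank_ker_lsmul x
    _ ≤ Module.finrank k g.range := Submodule.finrank_mono hg
    _ ≤ Module.finrank k f.range := finrank_range_le_of_ker_le hfg
    _ < Module.finrank k (R ⧸ Ideal.span {x}) := Submodule.finrank_lt hf

end TorsionQuotient

section Main

open UniversallyFiniteDifferentials

variable {k R : Type*} [Field k] [CharZero k] [CommRing R] [IsLocalRing R] [IsNoetherianRing R]
  [Algebra k R] {N : ℕ} {Φ : MvPowerSeries (Fin N) k →ₐ[k] R}

theorem isTorsion_quotient_span_d [IsDomain R] (hΦ : Function.Surjective Φ) {x : R}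
    (hx : x ∈ maximalIdeal R) [Module.Finite k (R ⧸ Ideal.span {x})] :
    Module.IsTorsion R (UniversallyFiniteDifferentials Φ ⧸ R ∙ d hΦ x) := by
  let Y := UniversallyFiniteDifferentials Φ ⧸ R ∙ d hΦ x
  let p : UniversallyFiniteDifferentials Φ →ₗ[R] Y ⧸ Submodule.torsion R Y :=
    (Submodule.torsion R Y).mkQ ∘ₗ (R ∙ d hΦ x).mkQ
  have hx0 : (R ∙ d hΦ x).mkQ (d hΦ x) = 0 :=
    (Submodule.Quotient.mk_eq_zero _).2 (Submodule.mem_span_singleton_self _)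
  have hpd : p.compDer (d hΦ) = 0 := derivation_eq_zero_of_apply_eq_zero hΦ hx
    (show (Submodule.torsion R Y).mkQ ((R ∙ d hΦ x).mkQ (d hΦ x)) = 0 by rw [hx0, map_zero])
  have hp : p = 0 := LinearMap.ext_on_range (span_range_d hΦ) fun r => Derivation.congr_fun hpd r
  intro y
  obtain ⟨ω, rfl⟩ := Submodule.Quotient.mk_surjective _ y
  exact (Submodule.mem_torsion_iff _).1
    ((Submodule.Quotient.mk_eq_zero _).1 (LinearMap.congr_fun hp ω))

theorem choose_add_finrank_sub_one_le_finrank_quotSMulTop (hΦ : Function.Surjective Φ)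
    (ε : R →ₐ[k] k) {x : R} (hx : x ∈ maximalIdeal R) {b : Ideal R} (hxb : x ∈ b)
    (hb : maximalIdeal R ^ 4 ≤ b)
    [Module.Finite k (UniversallyFiniteDifferentials Φ ⧸ R ∙ d hΦ x)] [Module.Finite k (R ⧸ b)] :
    ((maximalIdeal R).spanFinrank - 1).choose 2 + (Module.finrank k (R ⧸ b) - 1) ≤
      Module.finrank k (QuotSMulTop x (UniversallyFiniteDifferentials Φ ⧸ R ∙ d hΦ x)) := by
  obtain ⟨ψ, hψd, hψ, hΛ⟩ := exists_relativeExteriorDerivative hΦ ε hx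
  let V := CotangentSpace R ⧸ R ∙ cotangentDerivation ε x
  have : Module.Finite k (CotangentSpace R) := finite_cotangentSpace ε
  have hV : Module.Finite k V := .quotient k _
  let ρ : UniversallyFiniteDifferentials Φ →ₗ[k]
      QuotSMulTop x (UniversallyFiniteDifferentials Φ ⧸ R ∙ d hΦ x) :=
    ((Submodule.mkQ _) ∘ₗ (R ∙ d hΦ x).mkQ).restrictScalars k
  let q : R →ₗ[k] (R ⧸ b) ⧸ k ∙ (1 : R ⧸ b) :=
    (k ∙ (1 : R ⧸ b)).mkQ ∘ₗ (Ideal.Quotient.mkₐ k b).toLinearMap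
  have hρψ : ρ.ker ≤ ψ.ker := fun ω hω => by
    obtain ⟨ω, a, rfl⟩ := mk_mk_eq_zero_iff.1 hω
    exact hψ ω a
  have hρq : (ρ ∘ₗ (d hΦ).toLinearMap).ker ≤ q.ker := fun r hr => by
    obtain ⟨ω, a, h⟩ := mk_mk_eq_zero_iff.1 hr
    obtain ⟨c, hc⟩ := exists_sub_algebraMap_mem_of_d_eq hΦ hb hxb h
    exact (Submodule.Quotient.mk_eq_zero _).2 (Submodule.mem_span_singleton.2
      ⟨c, (Algebra.algebraMap_eq_smul_one c).symm.trans (Ideal.Quotient.eq.2 hc).symm⟩)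
  have hq : q.range = ⊤ := LinearMap.range_eq_top.2
    ((Submodule.mkQ_surjective _).comp Ideal.Quotient.mk_surjective)
  have hψfin : Module.Finite k ψ.range := finite_range_of_ker_le hρψ
  have hle := finrank_range_add_finrank_range_le hρψ (LinearMap.ext hψd) hρq
  rw [hq, finrank_top] at hle
  calc _ ≤ Module.finrank k (⋀[k]^2 V) + Module.finrank k ((R ⧸ b) ⧸ k ∙ (1 : R ⧸ b)) := by
        rw [exteriorPower.finrank_eq]
        exact add_le_add (Nat.choose_le_choose 2
          (spanFinrank_sub_one_le_finrank_cotangentSpace_quotient ε _))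
          (finrank_sub_one_le_finrank_quotient_span_singleton 1)
    _ ≤ _ := (Nat.add_le_add_right (Submodule.finrank_mono hΛ) _).trans hle

theorem choose_le_finrank_of_torsion_eq_bot [IsDomain R] (hdim : ringKrullDim R = 1) {x : R}
    (hx : x ∈ maximalIdeal R) (hx2 : x ∉ maximalIdeal R ^ 2) {b : Ideal R} (hxb : x ∈ b)
    (hb : maximalIdeal R ^ 4 ≤ b) (hΦ : Function.Surjective Φ)
    (htors : Submodule.torsion R (UniversallyFiniteDifferentials Φ) = ⊥) :
    ((maximalIdeal R).spanFinrank - 1).choose 2 ≤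
      Module.finrank k (b.map (Ideal.Quotient.mk (Ideal.span {x}))) := by
  obtain ⟨ε⟩ := nonempty_augmentation hΦ
  have hx0 : x ≠ 0 := fun h => hx2 (h ▸ zero_mem _)
  have hle : Ideal.span {x} ≤ b := (Ideal.span_singleton_le_iff_mem _).2 hxb
  have hfin : Module.Finite k (R ⧸ Ideal.span {x}) := finite_quotient_span_singleton ε hdim hx0
  have hfinb : Module.Finite k (R ⧸ b) := .of_surjective
    (Ideal.Quotient.factorₐ k hle).toLinearMap (Ideal.Quotient.factor_surjective hle)
  have : Module.IsTorsionFree R (UniversallyFiniteDifferentials Φ) :=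
    Submodule.isTorsionFree_iff_torsion_eq_bot.2 htors
  obtain ⟨N, hN⟩ :=
    exists_maximalIdeal_pow_smul_eq_zero hdim (isTorsion_quotient_span_d hΦ hx)
  have hfinY : Module.Finite k (UniversallyFiniteDifferentials Φ ⧸ R ∙ d hΦ x) :=
    finite_of_pow_maximalIdeal_smul_eq_zero ε hN
  have hlower := choose_add_finrank_sub_one_le_finrank_quotSMulTop hΦ ε hx hxb hb
  have hupper := finrank_quotSMulTop_quotient_lt (k := k) hx0
    fun ω hω => hx2 (mem_maximalIdeal_sq_of_d_eq_smul hΦ hx hω)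
  have hcount := finrank_map_add_finrank_quotient (k := k) hle
  omega

end Main

theorem mainTheorem1_general {k R : Type*} [Field k] [CharZero k] [CommRing R] [IsDomain R]
    [IsLocalRing R] [IsNoetherianRing R] [Algebra k R] (hdim : ringKrullDim R = 1) {x : R}
    (hx : x ∈ maximalIdeal R) (hx2 : x ∉ maximalIdeal R ^ 2) {b : Ideal R} (hxb : x ∈ b)
    (hb : maximalIdeal R ^ 4 ≤ b)
    (hs : 2 * (Module.finrank k (b.map (Ideal.Quotient.mk (Ideal.span {x}))) : ℤ) ≤
      ((maximalIdeal R).spanFinrank : ℤ) * ((maximalIdeal R).spanFinrank - 3))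
    {N : ℕ} {Φ : MvPowerSeries (Fin N) k →ₐ[k] R} (hΦ : Function.Surjective Φ) :
    Submodule.torsion R (UniversallyFiniteDifferentials Φ) ≠ ⊥ ∧
      (IsRegularLocalRing R ↔ Submodule.torsion R (UniversallyFiniteDifferentials Φ) = ⊥) := by
  have hn : 1 ≤ (maximalIdeal R).spanFinrank := Nat.one_le_iff_ne_zero.2 fun h =>
    maximalIdeal_ne_bot_of_ringKrullDim_eq_one hdim
      ((Submodule.spanFinrank_eq_zero_iff_eq_bot (IsNoetherian.noetherian _)).1 h)
  have htors : Submodule.torsion R (UniversallyFiniteDifferentials Φ) ≠ ⊥ := fun h => by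
    have hle := choose_le_finrank_of_torsion_eq_bot hdim hx hx2 hxb hb hΦ h
    rw [← Nat.cast_le (α := ℚ), Nat.cast_choose_two, Nat.cast_sub hn] at hle
    qify at hs
    push_cast at hle
    linarith
  have hsing : ¬ IsRegularLocalRing R := fun hreg => by
    have h1 : (maximalIdeal R).spanFinrank = 1 := by
      exact_mod_cast ((isRegularLocalRing_iff R).1 hreg).trans hdim
    rw [h1] at hs
    omega
  exact ⟨htors, iff_of_false hsing htors⟩

theorem mainTheorem1 (k : Type*) [Field k] [IsAlgClosed k] [CharZero k]
    (R : Type*) [CommRing R] [IsDomain R] [IsLocalRing R] [IsNoetherianRing R] [Algebra k R]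
    [IsAdicComplete (maximalIdeal R) R]
    (hres : Function.Bijective (algebraMap k (ResidueField R)))
    (hdim : ringKrullDim R = 1)
    (n : ℕ) (hn : (maximalIdeal R).spanFinrank = n)
    (x : R) (hx : IsMinimalReductionOf (Ideal.span {x}) (maximalIdeal R))
    (hm : maximalIdeal R ^ 4 ≤ conductorIdeal R ⊔ Ideal.span {x})
    (hs : 2 * (reducedType k R x : ℤ) ≤ (n : ℤ) * ((n : ℤ) - 3))
    (Φ : MvPowerSeries (Fin n) k →ₐ[k] R) (hΦ : Function.Surjective Φ) :
    Submodule.torsion R (UniversallyFiniteDifferentials Φ) ≠ ⊥ ∧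
      (IsRegularLocalRing R ↔ Submodule.torsion R (UniversallyFiniteDifferentials Φ) = ⊥) := by
  subst hn
  have hxx := Ideal.mem_span_singleton_self x
  exact mainTheorem1_general hdim (hx.prop.1 hxx) (hx.prop.notMem_maximalIdeal_sq hdim)
    (Ideal.mem_sup_right hxx) hm hs hΦ
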